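/- For a finite group $G$ and a prime $p$, let $I_p(G)$ be the set of elements of order $p$ in $G$. For $g\in G$ let $w_p(g)$ be the least $k\ge 0$ such that $g=x_1\cdots x_k$ with all $x_i\in I_p(G)$ (the empty product being $1$, and $w_p(g)=\infty$ if there is no such $k$), and let $w_p(G)=\max_{g\in G}w_p(g)$ be the $p$-width of $G$. A transvection is a non-identity linear map of the form $x\mapsto x+f(x)v$, where $f$ is a linear form and $v$ a vector with $f(v)=0$. **Proposition.** Let $p\neq l$ be primes such that $p$ is odd and $l$ is a primitive root modulo $p$, that is, $l$ has multiplicative order $p-1$ modulo $p$. Let $G$ be either $SL_{p-1}(l)$ or $Sp_{p-1}(l)$, the special linear or symplectic group of dimension $p-1$ over the field with $l$ elements. Then $w_p(G)\ge 3$. More precisely, $G$ contains transvections, and every transvection $t\in G$ satisfies $w_p(t)\ge 3$; in particular, $t$ is not a product of two elements of order $p$ of $G$. -/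

import Mathlib

open scoped Pointwise

/-- The set `I_p(G)` of elements of order `p` in `G`. -/
def orderElements (p : ℕ) (G : Type*) [Group G] : Set G := {x | orderOf x = p}

/-- The `p`-width `w_p(g)`: the least `k` such that `g = x₁ ⋯ x_k` with all `xᵢ` of order `p`.
It is `⊤` if `g` is not a product of elements of order `p`. -/
noncomputable def elementPWidth (p : ℕ) {G : Type*} [Group G] (g : G) : ℕ∞ :=
  ⨅ k ∈ {k : ℕ | g ∈ orderElements p G ^ k}, (k : ℕ∞)

/-- The `p`-width `w_p(G)`: the largest `p`-width of an element of `G`. -/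
noncomputable def pWidth (p : ℕ) (G : Type*) [Group G] : ℕ∞ :=
  ⨆ g : G, elementPWidth p g

/-- A square matrix is a transvection if it is not the identity and acts on column vectors as
`x ↦ x + f x • v` for a linear form `f` and a vector `v` with `f v = 0`. -/
def Matrix.IsTransvectionMatrix {n R : Type*} [Fintype n] [DecidableEq n] [CommRing R]
    (A : Matrix n n R) : Prop :=
  A ≠ 1 ∧ ∃ (f : Module.Dual R (n → R)) (v : n → R), f v = 0 ∧
    Matrix.toLin' A = LinearMap.transvection f v

/-!
Since `l` is a primitive root modulo `p`, the cyclotomic polynomial `Φ_p` is irreducible over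
`ZMod l`, and its degree `p - 1` is the dimension of the natural module `V`. An element of order `p`
therefore has characteristic polynomial `Φ_p` and acts irreducibly on `V`
(`Module.End.aeval_cyclotomic_eq_zero`).

If a transvection `t` were a product `x * y` of two elements of order `p`, then `x` and `z = y⁻¹`
would be distinct, both annihilated by `Φ_p`, and `x - z` would have rank one. This is impossible
(`Module.End.eq_of_aeval_irreducible_eq_zero`): if `x - z` is `u ↦ g u • v`, then the `p - 2` linear
conditions `g (z ^ i w) = 0`, for `i < p - 2`, have a common nonzero solution `w`. On it
`x ^ i w = z ^ i w` for all `i < p - 1`, hence for all `i` because `Φ_p` annihilates both maps; as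
`w` is a cyclic vector for `z`, it follows that `x = z`.

Products with at most one factor reduce to the case of two factors, because an element `x` of odd
order `p` equals `x ^ 2 * x⁻¹`.
-/

open Polynomial Module

/-! ### Endomorphisms annihilated by an irreducible polynomial of maximal degree -/

section Endomorphisms

variable {K V : Type*} [Field K] [AddCommGroup V] [Module K V] [FiniteDimensional K V]

/-- Every nonzero vector is cyclic for an endomorphism annihilated by an irreducible polynomial whose
degree is the dimension of the space. -/
theorem Module.End.exists_aeval_apply_eq {q : K[X]} (hq : Irreducible q)
    (hdeg : q.natDegree = finrank K V) {y : End K V} (hy : aeval y q = 0) {w : V} (hw : w ≠ 0)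
    (u : V) : ∃ r : K[X], aeval y r w = u := by
  let ψ : degreeLT K q.natDegree →ₗ[K] V :=
    (LinearMap.applyₗ w ∘ₗ (aeval y).toLinearMap) ∘ₗ (degreeLT K q.natDegree).subtype
  have hψ (r : degreeLT K q.natDegree) : ψ r = aeval y (r : K[X]) w := rfl
  have hinj : Function.Injective ψ := by
    rw [← LinearMap.ker_eq_bot, LinearMap.ker_eq_bot']
    rintro ⟨r, hr⟩ h0
    rw [hψ] at h0
    by_contra hne
    have hr0 : r ≠ 0 := fun h => hne (Subtype.ext h)
    have hcop : IsCoprime q r := by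
      refine hq.coprime_iff_not_dvd.2 fun hdvd => ?_
      rw [mem_degreeLT, ← natDegree_lt_iff_degree_lt hr0] at hr
      exact absurd (natDegree_le_of_dvd hdvd hr0) (not_le.2 hr)
    obtain ⟨a, b, hab⟩ := hcop
    apply hw
    have := congrArg (fun s => aeval y s w) hab
    simpa [hy, h0] using this.symm
  have hfin : finrank K (degreeLT K q.natDegree) = finrank K V := by
    rw [(degreeLTEquiv K q.natDegree).finrank_eq, finrank_fin_fun, hdeg]
  have : FiniteDimensional K (degreeLT K q.natDegree) :=
    (degreeLTEquiv K q.natDegree).symm.finiteDimensional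
  obtain ⟨r, hr⟩ := (LinearMap.injective_iff_surjective_of_finrank_eq_finrank hfin).1 hinj u
  exact ⟨r, hr⟩

/-- Two endomorphisms that are annihilated by the same irreducible polynomial, of degree the
dimension of the space, and whose difference has rank at most one, are equal. -/
theorem Module.End.eq_of_aeval_irreducible_eq_zero {q : K[X]} (hq : Irreducible q)
    (hdeg : q.natDegree = finrank K V) {x y : End K V} (hx : aeval x q = 0) (hy : aeval y q = 0)
    (g : Dual K V) (v : V) (hxy : ∀ u, x u = y u + g u • v) : x = y := by
  have hpos : 0 < finrank K V := hdeg ▸ hq.natDegree_pos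
  -- There are fewer conditions `g (y ^ i w) = 0` than the dimension, so they have a solution.
  obtain ⟨w, hw, hw0⟩ : ∃ w : V, w ≠ 0 ∧ ∀ i < finrank K V - 1, g ((y ^ i) w) = 0 := by
    let ψ : V →ₗ[K] Fin (finrank K V - 1) → K := LinearMap.pi fun i => g ∘ₗ (y ^ (i : ℕ))
    have hker : LinearMap.ker ψ ≠ ⊥ := LinearMap.ker_ne_bot_of_finrank_lt (by simp; omega)
    obtain ⟨w, hw, hne⟩ := Submodule.exists_mem_ne_zero_of_ne_bot hker
    exact ⟨w, hne, fun i hi => congrFun (LinearMap.mem_ker.1 hw) ⟨i, hi⟩⟩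
  have hpow : ∀ i < q.natDegree, (x ^ i) w = (y ^ i) w := by
    intro i
    induction i with
    | zero => simp
    | succ i ih =>
      intro hi
      rw [pow_succ', pow_succ', Module.End.mul_apply, Module.End.mul_apply, ih (by omega), hxy,
        hw0 i (by omega), zero_smul, add_zero]
  have hsmall (r : K[X]) (hr : r.natDegree < q.natDegree) : aeval x r w = aeval y r w := by
    rw [aeval_eq_sum_range' hr, aeval_eq_sum_range' hr, LinearMap.sum_apply, LinearMap.sum_apply]
    refine Finset.sum_congr rfl fun i hi => ?_
    rw [LinearMap.smul_apply, LinearMap.smul_apply, hpow i (Finset.mem_range.1 hi)]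
  have hall (r : K[X]) : aeval x r w = aeval y r w := by
    have h := hsmall (r % q) (natDegree_mod_lt r hq.natDegree_pos.ne')
    rw [← EuclideanDomain.div_add_mod r q]
    simpa [hx, hy] using h
  ext u
  obtain ⟨r, rfl⟩ := Module.End.exists_aeval_apply_eq hq hdeg hy hw u
  have h := hall (X * r)
  rwa [map_mul, map_mul, aeval_X, aeval_X, Module.End.mul_apply, Module.End.mul_apply, hall r] at h

/-- If `Φ_p` is irreducible of degree the dimension of the space, then it is the characteristic
polynomial of every endomorphism of order `p`, which it therefore annihilates. -/
theorem Module.End.aeval_cyclotomic_eq_zero {p : ℕ} (hp : p.Prime)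
    (hirr : Irreducible (cyclotomic p K)) (hdim : finrank K V = p - 1) {x : End K V}
    (hx : orderOf x = p) : aeval x (cyclotomic p K) = 0 := by
  have := Fact.mk hp
  have hmul : minpoly K x ∣ cyclotomic p K * (X - 1) := by
    rw [cyclotomic_prime_mul_X_sub_one]
    apply minpoly.dvd
    rw [map_sub, map_pow, aeval_X, map_one, ← hx, pow_orderOf_eq_one, sub_self]
  have hdvd : cyclotomic p K ∣ minpoly K x := by
    by_contra hnd
    have h1 := (hirr.coprime_iff_not_dvd.2 hnd).symm.dvd_of_dvd_mul_left hmul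
    have h2 : aeval x (X - 1 : K[X]) = 0 := (minpoly.dvd_iff).1 h1
    rw [map_sub, aeval_X, map_one, sub_eq_zero] at h2
    rw [h2, orderOf_one] at hx
    exact hp.one_lt.ne hx
  have heq : x.charpoly = cyclotomic p K := by
    refine eq_of_monic_of_dvd_of_natDegree_le (cyclotomic.monic p K) x.charpoly_monic
      (hdvd.trans x.minpoly_dvd_charpoly) ?_
    rw [LinearMap.charpoly_natDegree, natDegree_cyclotomic, Nat.totient_prime hp, hdim]
  rw [← heq, LinearMap.aeval_self_charpoly]

end Endomorphisms

theorem ZMod.irreducible_cyclotomic_of_isPrimitiveRoot {p l : ℕ} (hp : p.Prime) (hl : l.Prime)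
    (hpl : p ≠ l) (hprim : IsPrimitiveRoot (l : ZMod p) (p - 1)) :
    Irreducible (cyclotomic p (ZMod l)) := by
  have := Fact.mk hl
  have hlp : ¬ l ∣ p := fun h => hpl ((Nat.prime_dvd_prime_iff_eq hl hp).1 h).symm
  refine ZMod.irreducible_of_dvd_cyclotomic_of_natDegree hlp dvd_rfl ?_
  rw [natDegree_cyclotomic, Nat.totient_prime hp, ← orderOf_units, ZMod.coe_unitOfCoprime,
    hprim.eq_orderOf]

/-! ### Transvections in matrix groups -/

/-- In a linear group of dimension `p - 1` over a field where `Φ_p` is irreducible, a transvection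
is not a product of two elements of order `p`. -/
theorem Matrix.IsTransvectionMatrix.ne_mul_of_orderOf_eq {n K G : Type*} [Fintype n]
    [DecidableEq n] [Field K] [Group G] {φ : G →* Matrix n n K} (hφ : Function.Injective φ)
    {p : ℕ} (hp : p.Prime) (hirr : Irreducible (cyclotomic p K)) (hcard : Fintype.card n = p - 1)
    {t x y : G} (ht : (φ t).IsTransvectionMatrix) (hx : orderOf x = p) (hy : orderOf y = p) :
    t ≠ x * y := by
  intro hxy
  obtain ⟨hne, f, v, -, hfv⟩ := ht
  let Φ : G →* End K (n → K) := (Matrix.toLinAlgEquiv' : Matrix n n K ≃ₐ[K] _).toMonoidHom.comp φ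
  have hΦ : Function.Injective Φ := (Matrix.toLinAlgEquiv' (R := K) (n := n)).injective.comp hφ
  have hdim : finrank K (n → K) = p - 1 := by rw [finrank_fintype_fun_eq_card, hcard]
  have hdeg : (cyclotomic p K).natDegree = finrank K (n → K) := by
    rw [natDegree_cyclotomic, Nat.totient_prime hp, hdim]
  have hΦt : Φ t = LinearMap.transvection f v := hfv
  have heq : Φ x = Φ y⁻¹ := by
    refine Module.End.eq_of_aeval_irreducible_eq_zero hirr hdeg
      (Module.End.aeval_cyclotomic_eq_zero hp hirr hdim ((orderOf_injective Φ hΦ x).trans hx))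
      (Module.End.aeval_cyclotomic_eq_zero hp hirr hdim
        ((orderOf_injective Φ hΦ y⁻¹).trans ((orderOf_inv y).trans hy)))
      (f ∘ₗ Φ y⁻¹) v fun u => ?_
    rw [eq_mul_inv_of_mul_eq hxy.symm, map_mul, hΦt]
    rfl
  apply hne
  rw [hxy, hΦ heq, inv_mul_cancel, map_one]

theorem Matrix.isTransvectionMatrix_transvection {n R : Type*} [Fintype n] [DecidableEq n]
    [CommRing R] [Nontrivial R] {i j : n} (hij : i ≠ j) :
    (Matrix.transvection i j (1 : R)).IsTransvectionMatrix := by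
  refine ⟨fun h => ?_, LinearMap.proj j, Pi.single i 1, by simp [hij.symm], ?_⟩
  · have := congrFun (congrFun h i) j
    simp [Matrix.transvection, hij] at this
  · ext k m
    simp [Matrix.transvection, LinearMap.transvection, Matrix.single_apply]
    by_cases hj : j = k <;> simp [hj, Pi.single_apply, eq_comm]

theorem Matrix.transvection_mem_symplecticGroup {n R : Type*} [Fintype n] [DecidableEq n]
    [CommRing R] (i : n) (c : R) :
    Matrix.transvection (Sum.inl i) (Sum.inr i) c ∈ Matrix.symplecticGroup n R := by
  have h : Matrix.transvection (Sum.inl i) (Sum.inr i) c =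
      Matrix.fromBlocks 1 (Matrix.single i i c) 0 1 := by
    ext (a | a) (b | b) <;> simp [Matrix.transvection, Matrix.single_apply, Matrix.one_apply]
  rw [h, SymplecticGroup.fromBlocks_mem_iff]
  simp

/-! ### Widths -/

/-- An element of odd order `p` is a product of two elements of order `p`, so products of one
element need no separate treatment. -/
theorem exists_mul_eq_of_orderOf_eq {p : ℕ} (hodd : Odd p) {G : Type*} [Group G] {g : G}
    (hg : orderOf g = p) : ∃ x y : G, orderOf x = p ∧ orderOf y = p ∧ g = x * y := by
  refine ⟨g ^ 2, g⁻¹, ?_, (orderOf_inv g).trans hg, by rw [pow_two, mul_inv_cancel_right]⟩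
  rw [Nat.Coprime.orderOf_pow, hg]
  rw [hg]
  exact hodd.coprime_two_right

theorem three_le_elementPWidth {p : ℕ} (hodd : Odd p) {G : Type*} [Group G] {g : G} (hg : g ≠ 1)
    (hmul : ¬ ∃ x y : G, orderOf x = p ∧ orderOf y = p ∧ g = x * y) :
    3 ≤ elementPWidth p g := by
  refine le_iInf₂ fun k (hk : g ∈ orderElements p G ^ k) => ?_
  by_contra hlt
  have hk3 : k < 3 := by exact_mod_cast not_le.1 hlt
  interval_cases k
  · exact hg (by simpa using hk)
  · exact hmul (exists_mul_eq_of_orderOf_eq hodd (by rwa [pow_one] at hk))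
  · rw [pow_two] at hk
    obtain ⟨x, hx, y, hy, rfl⟩ := Set.mem_mul.1 hk
    exact hmul ⟨x, y, hx, hy, rfl⟩

theorem Matrix.IsTransvectionMatrix.three_le_pWidth {n K G : Type*} [Fintype n]
    [DecidableEq n] [Field K] [Group G] {φ : G →* Matrix n n K} (hφ : Function.Injective φ)
    {p : ℕ} (hp : p.Prime) (hodd : Odd p) (hirr : Irreducible (cyclotomic p K))
    (hcard : Fintype.card n = p - 1) (hex : ∃ t : G, (φ t).IsTransvectionMatrix) :
    3 ≤ pWidth p G ∧ (∃ t : G, (φ t).IsTransvectionMatrix) ∧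
      ∀ t : G, (φ t).IsTransvectionMatrix →
        (¬ ∃ x y : G, orderOf x = p ∧ orderOf y = p ∧ t = x * y) ∧ 3 ≤ elementPWidth p t := by
  have key (t : G) (ht : (φ t).IsTransvectionMatrix) :
      (¬ ∃ x y : G, orderOf x = p ∧ orderOf y = p ∧ t = x * y) ∧ 3 ≤ elementPWidth p t := by
    have hmul : ¬ ∃ x y : G, orderOf x = p ∧ orderOf y = p ∧ t = x * y :=
      fun ⟨_, _, hx, hy, hxy⟩ => ht.ne_mul_of_orderOf_eq hφ hp hirr hcard hx hy hxy
    refine ⟨hmul, three_le_elementPWidth hodd ?_ hmul⟩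
    rintro rfl
    exact ht.1 (map_one φ)
  refine ⟨?_, hex, key⟩
  obtain ⟨t, ht⟩ := hex
  exact (key t ht).2.trans (le_iSup (elementPWidth p) t)

theorem mainTheorem11 (p l : ℕ) (hp : p.Prime) (hl : l.Prime) (hpl : p ≠ l) (hodd : Odd p)
    (hprim : IsPrimitiveRoot (l : ZMod p) (p - 1)) :
    (3 ≤ pWidth p (Matrix.SpecialLinearGroup (Fin (p - 1)) (ZMod l)) ∧
      (∃ t : Matrix.SpecialLinearGroup (Fin (p - 1)) (ZMod l),
        (t : Matrix (Fin (p - 1)) (Fin (p - 1)) (ZMod l)).IsTransvectionMatrix) ∧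
      ∀ t : Matrix.SpecialLinearGroup (Fin (p - 1)) (ZMod l),
        (t : Matrix (Fin (p - 1)) (Fin (p - 1)) (ZMod l)).IsTransvectionMatrix →
          (¬ ∃ x y : Matrix.SpecialLinearGroup (Fin (p - 1)) (ZMod l),
            orderOf x = p ∧ orderOf y = p ∧ t = x * y) ∧
          3 ≤ elementPWidth p t) ∧
    (3 ≤ pWidth p (Matrix.symplecticGroup (Fin ((p - 1) / 2)) (ZMod l)) ∧
      (∃ t : Matrix.symplecticGroup (Fin ((p - 1) / 2)) (ZMod l),
        (t : Matrix (Fin ((p - 1) / 2) ⊕ Fin ((p - 1) / 2))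
          (Fin ((p - 1) / 2) ⊕ Fin ((p - 1) / 2)) (ZMod l)).IsTransvectionMatrix) ∧
      ∀ t : Matrix.symplecticGroup (Fin ((p - 1) / 2)) (ZMod l),
        (t : Matrix (Fin ((p - 1) / 2) ⊕ Fin ((p - 1) / 2))
          (Fin ((p - 1) / 2) ⊕ Fin ((p - 1) / 2)) (ZMod l)).IsTransvectionMatrix →
          (¬ ∃ x y : Matrix.symplecticGroup (Fin ((p - 1) / 2)) (ZMod l),
            orderOf x = p ∧ orderOf y = p ∧ t = x * y) ∧
          3 ≤ elementPWidth p t) := by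
  have := Fact.mk hl
  have hirr := ZMod.irreducible_cyclotomic_of_isPrimitiveRoot hp hl hpl hprim
  have hp2 := hp.two_le
  obtain ⟨m, hm⟩ := hodd
  constructor
  · refine Matrix.IsTransvectionMatrix.three_le_pWidth
      Matrix.SpecialLinearGroup.coeMonoidHom_injective hp ⟨m, hm⟩ hirr (by simp) ?_
    have h01 : (⟨0, by omega⟩ : Fin (p - 1)) ≠ ⟨1, by omega⟩ := by simp
    exact ⟨⟨_, Matrix.det_transvection_of_ne _ _ h01 1⟩,
      Matrix.isTransvectionMatrix_transvection h01⟩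
  · refine Matrix.IsTransvectionMatrix.three_le_pWidth
      (φ := (Matrix.symplecticGroup (Fin ((p - 1) / 2)) (ZMod l)).subtype)
      Subtype.val_injective hp ⟨m, hm⟩ hirr (by simp; omega) ?_
    exact ⟨⟨_, Matrix.transvection_mem_symplecticGroup ⟨0, by omega⟩ 1⟩,
      Matrix.isTransvectionMatrix_transvection Sum.inl_ne_inr⟩
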